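/- Let $M\ge 1$ and $K\ge 2$ be integers and let $0<m_1<\dots<m_K$ be pairwise coprime integers with $m_{K-1}\ge 3$. Put $M_k=Mm_k$ and $$d=\min_{I\subseteq\{1,\dots,K\}}\Big\{\prod_{i\in I}m_i+\prod_{i\notin I}m_i\Big\}.$$ Let $N_1,N_2\ge 0$ be integers, $r_{l,k}\in\{0,\dots,M_k-1\}$ the remainder of $N_l$ modulo $M_k$, $\Delta r_{l,k}$ real remainder errors, $\tilde r_{l,k}=r_{l,k}+\Delta r_{l,k}$, and $\tau=\max_{l,k}|\Delta r_{l,k}|$. Only the unordered erroneous residue sets $\{\tilde r_{1,k},\tilde r_{2,k}\}$, $k=1,\dots,K$, are given to the procedure (a set with one element counts it twice). *Notation.* $\langle x\rangle_M=x-M\lfloor x/M\rfloor$; $[u]$ is the integer with $-1/2\le u-[u]<1/2$; and $d_M(x,y)=x-y-\big[\tfrac{x-y}{M}\big]M$. *The robust generalized CRT procedure.* 1. Let $\alpha_1\le\dots\le\alpha_{2K}$ be the $2K$ numbers $\langle\tilde r_{l,k}\rangle_M$ (with multiplicity), sorted. Put $D_i=\alpha_{i+1}-\alpha_i$ for $i<2K$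 and $D_{2K}=\alpha_1-\alpha_{2K}+M$. Let $k_0\in\{1,\dots,K\}$ be such that $D_{k_0}+D_{k_0+K}>M/2$. 2. Form the two clusters $(\omega_1,\dots,\omega_K)=(\alpha_{k_0+1},\dots,\alpha_{k_0+K})$ and $(\upsilon_1,\dots,\upsilon_K)=(\alpha_{k_0+K+1}-M,\dots,\alpha_{2K}-M,\alpha_1,\dots,\alpha_{k_0})$. Put $\omega'_j=\omega_j$ for all $j$ if $\omega_K-\upsilon_1\le M/2$, and $\omega'_j=\omega_j-M$ for all $j$ otherwise. Let $\overline\omega_1=\frac1K\sum_j\omega'_j$, $\overline\omega_2=\frac1K\sum_j\upsilon_j$ and $\Omega'=\{\omega'_1,\dots,\omega'_K,\upsilon_1,\dots,\upsilon_K\}$. 3. Put $\hat q_{l,k}=\big[(\tilde r_{l,k}-\overline\omega_t)/M\big]$, where $t=1$ if $d_M(\langle\tilde r_{l,k}\rangle_M,\omega_j)=0$ for some $j$, and $t=2$ if $d_M(\langle\tilde r_{l,k}\rangle_M,\upsilon_j)=0$ for some $j$ (either choice is allowed if both hold). 4. By the generalized CRT for two integers, find $\hat Q_1,\hat Q_2\in\{0,\dots,d-1\}$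 whose residue set modulo $m_k$ is that of $\{\hat q_{1,k},\hat q_{2,k}\}$ for every $k$. 5. If $\hat Q_1=\hat Q_2=\hat Q$, put $\{\hat N_1,\hat N_2\}=\{M\hat Q+\overline\omega_1,\,M\hat Q+\overline\omega_2\}$. If $\hat Q_1\ne\hat Q_2$, let $\mathcal K$ be the set of the $k$ with $\hat Q_1\not\equiv\hat Q_2 \pmod{m_k}$. For $k\in\mathcal K$ let $\tilde r_{(l),k}$ be the member of the $k$-th erroneous residue set whose $\hat q$ is congruent to $\hat Q_l$ modulo $m_k$, and let $\hat r^c_{l,k}\in\Omega'$ be such that $d_M(\tilde r_{(l),k},\hat r^c_{l,k})=0$. Put $\hat N_l=M\hat Q_l+\frac1{|\mathcal K|}\sum_{k\in\mathcal K}\hat r^c_{l,k}$. **Theorem.** Assume that $\tau<M/8$, that $N_l+\Delta r_{l,k}\ge 0$ for all $l,k$ (which holds, for instance, if all erroneous remainders are nonnegative or if $N_1,N_2\ge\tau$), and that $N_l\le M\big(d-\tfrac12\big)-3\tau$ for $l=1,2$. Then the procedure can be carried out, and, whichever choices are made in it, the estimates satisfy, after numbering them suitably, $$|\hat N_l-N_l|\le\tau,\qquad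 l=1,2.$$ -/

import Mathlib

open scoped BigOperators

namespace RobustCRT

noncomputable section

/-- `d = min_I (∏_{i ∈ I} m_i + ∏_{i ∉ I} m_i)`, the minimum being over all sets `I` of indices. -/
def dynRange {K : ℕ} (m : Fin K → ℕ) : ℕ :=
  (Finset.univ : Finset (Finset (Fin K))).inf' ⟨∅, Finset.mem_univ _⟩
    (fun I => (∏ i ∈ I, m i) + ∏ i ∈ Iᶜ, m i)

/-- `⟨x⟩_M`, the remainder in `[0, M)` of a real number `x` modulo `M`. -/
def rem (M x : ℝ) : ℝ := x - M * ⌊x / M⌋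

/-- The circular distance `d_C(x, y) = x - y - [(x - y) / C] C`; here `round` is the rounding
`[u]` with `-1/2 ≤ u - [u] < 1/2`. -/
def circDist (C x y : ℝ) : ℝ := x - y - (round ((x - y) / C) : ℝ) * C

/-! In what follows `x l k` (`l : Fin 2`, `k : Fin K`) is an enumeration of the observed
erroneous residue sets: `x 0 k`, `x 1 k` are the two members of the `k`-th one. -/

/-- The `2K` erroneous common remainders, with multiplicity. -/
def commonRems {K : ℕ} (M : ℝ) (x : Fin 2 → Fin K → ℝ) : Multiset ℝ :=
  (Finset.univ : Finset (Fin 2 × Fin K)).val.map (fun p => rem M (x p.1 p.2))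

/-- The `i`-th smallest erroneous common remainder, `1 ≤ i ≤ 2K` (indices start at `1`). -/
def sortedRem {K : ℕ} (M : ℝ) (x : Fin 2 → Fin K → ℝ) (i : ℕ) : ℝ :=
  ((commonRems M x).sort (· ≤ ·)).getD (i - 1) 0

/-- The distances `D_i`, `1 ≤ i ≤ 2K`, of circularly adjacent common remainders. -/
def gap {K : ℕ} (M : ℝ) (x : Fin 2 → Fin K → ℝ) (i : ℕ) : ℝ :=
  if i < 2 * K then sortedRem M x (i + 1) - sortedRem M x i
  else sortedRem M x 1 - sortedRem M x (2 * K) + M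

/-- The first cluster `Ω₁ = {ω_1 ≤ … ≤ ω_K}`; `omega M x k₀ j` is `ω_j`, `1 ≤ j ≤ K`. -/
def omega {K : ℕ} (M : ℝ) (x : Fin 2 → Fin K → ℝ) (k₀ j : ℕ) : ℝ :=
  sortedRem M x (k₀ + j)

/-- The second cluster `Ω₂ = {υ_1 ≤ … ≤ υ_K}`: first the common remainders number
`k₀ + K + 1, …, 2K`, each minus `M`, then those number `1, …, k₀`. -/
def upsilon {K : ℕ} (M : ℝ) (x : Fin 2 → Fin K → ℝ) (k₀ j : ℕ) : ℝ :=
  if j ≤ K - k₀ then sortedRem M x (k₀ + K + j) - M else sortedRem M x (j - (K - k₀))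

/-- The shifted first cluster `ω'_1, …, ω'_K`. -/
def omega' {K : ℕ} (M : ℝ) (x : Fin 2 → Fin K → ℝ) (k₀ j : ℕ) : ℝ :=
  if omega M x k₀ K - upsilon M x k₀ 1 ≤ M / 2 then omega M x k₀ j else omega M x k₀ j - M

/-- The clusters `Ω₁` (index `0`) and `Ω₂` (index `1`). -/
def cluster {K : ℕ} (M : ℝ) (x : Fin 2 → Fin K → ℝ) (k₀ : ℕ) (t : Fin 2) (j : ℕ) : ℝ :=
  if t = 0 then omega M x k₀ j else upsilon M x k₀ j

/-- The averages of `ω'_1, …, ω'_K` (index `0`) and of `υ_1, …, υ_K` (index `1`). -/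
def clusterMean {K : ℕ} (M : ℝ) (x : Fin 2 → Fin K → ℝ) (k₀ : ℕ) (t : Fin 2) : ℝ :=
  (∑ j ∈ Finset.Icc 1 K, if t = 0 then omega' M x k₀ j else upsilon M x k₀ j) / K

/-- `Ω' = {ω'_1, …, ω'_K, υ_1, …, υ_K}`. -/
def omegaSet {K : ℕ} (M : ℝ) (x : Fin 2 → Fin K → ℝ) (k₀ : ℕ) : Set ℝ :=
  {c | ∃ j ∈ Finset.Icc 1 K, c = omega' M x k₀ j ∨ c = upsilon M x k₀ j}

/-- `q̂_{l,k} = [(x_{l,k} - ω̄_t) / M]`, where `t = t l k` is the cluster chosen for `x_{l,k}`. -/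
def qhat {K : ℕ} (M : ℝ) (x : Fin 2 → Fin K → ℝ) (k₀ : ℕ) (t : Fin 2 → Fin K → Fin 2)
    (l : Fin 2) (k : Fin K) : ℤ :=
  round ((x l k - clusterMean M x k₀ (t l k)) / M)

/-- The generalized CRT for two integers: `Q 0, Q 1` lie in `{0, …, d - 1}` and, for every `k`,
their residue set modulo `m k` is that of the unordered pair `S k`. -/
def IsGCRT {K : ℕ} (m : Fin K → ℕ) (S : Fin K → Sym2 ℤ) (Q : Fin 2 → ℤ) : Prop :=
  (∀ l, 0 ≤ Q l ∧ Q l < dynRange m) ∧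
    ∀ k, (S k).map (fun z : ℤ => (z : ZMod (m k))) = s((Q 0 : ZMod (m k)), (Q 1 : ZMod (m k)))

open Classical in
/-- The set of the indices `k` at which `Q 0` and `Q 1` have different residues modulo `m k`. -/
def diffIdx {K : ℕ} (m : Fin K → ℕ) (Q : Fin 2 → ℤ) : Finset (Fin K) :=
  Finset.univ.filter (fun k => ¬ (Q 0 ≡ Q 1 [ZMOD (m k : ℤ)]))

/-- `Nh 0, Nh 1` are the estimates which a run of the robust generalized CRT produces from the
unordered erroneous residue sets `R k` (a set with one element counts it twice). Wherever the
procedure leaves a choice (the enumeration `x` of the residue sets, the cluster `t l k` when both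
are admissible), any choice is allowed. -/
def IsEstimate {K : ℕ} (M : ℝ) (m : Fin K → ℕ) (R : Fin K → Sym2 ℝ) (Nh : Fin 2 → ℝ) : Prop :=
  ∃ (x : Fin 2 → Fin K → ℝ) (k₀ : ℕ) (t : Fin 2 → Fin K → Fin 2) (Q : Fin 2 → ℤ),
    -- `x` enumerates the observed residue sets
    (∀ k, R k = s(x 0 k, x 1 k)) ∧
    -- the index that determines the two clusters
    (1 ≤ k₀ ∧ k₀ ≤ K ∧ M / 2 < gap M x k₀ + gap M x (k₀ + K)) ∧
    -- the common remainder of `x l k` belongs, modulo `M`, to the cluster number `t l k`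
    (∀ l k, ∃ j ∈ Finset.Icc 1 K,
      circDist M (rem M (x l k)) (cluster M x k₀ (t l k) j) = 0) ∧
    -- `Q` is reconstructed from the residue sets `{q̂_{1,k}, q̂_{2,k}}`
    IsGCRT m (fun k => s(qhat M x k₀ t 0 k, qhat M x k₀ t 1 k)) Q ∧
    -- the estimates when the two reconstructed integers are equal
    (Q 0 = Q 1 → ∀ l, Nh l = M * Q l + clusterMean M x k₀ l) ∧
    -- the estimates when they differ: for `k` in `diffIdx m Q` the member `x (p k l) k` of the
    -- residue set is the one that corresponds to `Q l`, and `c l k` is its representative in `Ω'`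
    (Q 0 ≠ Q 1 → ∃ (p : Fin K → Equiv.Perm (Fin 2)) (c : Fin 2 → Fin K → ℝ),
      (∀ k ∈ diffIdx m Q, ∀ l,
        qhat M x k₀ t (p k l) k ≡ Q l [ZMOD (m k : ℤ)] ∧
        c l k ∈ omegaSet M x k₀ ∧ circDist M (x (p k l) k) (c l k) = 0) ∧
      ∀ l, Nh l = M * Q l + (∑ k ∈ diffIdx m Q, c l k) / (diffIdx m Q).card)

/-- The erroneous remainder `r̃_{l,k} = ⟨N_l⟩_{M m_k} + Δr_{l,k}`. -/
def erroneousRem {K : ℕ} (M : ℕ) (m : Fin K → ℕ) (N : Fin 2 → ℕ) (Δr : Fin 2 → Fin K → ℝ)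
    (l : Fin 2) (k : Fin K) : ℝ :=
  ((N l % (M * m k) : ℕ) : ℝ) + Δr l k

end

end RobustCRT

namespace RobustCRT

/-! On the circle of length `M` the `2K` common remainders form two classes, each within `τ` of its
`N l`. Unrolling the circle (`extRem`) gives a nondecreasing sequence, and `Ω'` is a window of `2K`
consecutive terms of length less than `M` (`exists_window`). Two points of one class differ by at
most `2τ` modulo `M`. As `4τ < M/2`, either the whole window has length at most `4τ`, or no class
meets both halves (`range_le_or_pure`). In both cases a class spans less than `M/2`, so no multiple
of `M` intervenes: `N l + Δr l k = M * s l + c l k` with `c l k ∈ Ω'` and `s l` independent of `k`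
(`quotient_const`, `exists_quotient_representative`).

The rounded quotients have the residues of `s l` (`qhat_modEq`), and `s l` lies in `[0, d)`, so
uniqueness in the generalized CRT gives `{Q 0, Q 1} = {s 0, s 1}`. If these differ, some modulus
separates them; there the member belonging to `Q l` is known, and averaging keeps the error below
`τ`. If they agree, the classes may be inseparable, but the lower and upper halves of the sorted
points still lie within `τ` of the smaller and the larger number (`halves_near_centers`). -/

/-! ### Uniqueness for the generalized CRT -/

lemma dynRange_le {K : ℕ} (m : Fin K → ℕ) (I : Finset (Fin K)) :
    dynRange m ≤ (∏ i ∈ I, m i) + ∏ i ∈ Iᶜ, m i :=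
  Finset.inf'_le (fun I => (∏ i ∈ I, m i) + ∏ i ∈ Iᶜ, m i) (Finset.mem_univ I)

/-- Splitting off the second largest modulus `a ≥ 3` leaves a product `b ≥ 4`, and `(a - 2) * (b -
2) ≥ 2` gives the second bound. -/
lemma two_mul_dynRange_le {K : ℕ} (hK : 2 ≤ K) (m : Fin K → ℕ) (hpos : ∀ k, 0 < m k)
    (hmono : StrictMono m) (hthree : 3 ≤ m ⟨K - 2, by omega⟩) :
    dynRange m ≤ ∏ k, m k ∧ 2 * dynRange m ≤ (∏ k, m k) + 2 := by
  set i : Fin K := ⟨K - 2, by omega⟩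
  set j : Fin K := ⟨K - 1, by omega⟩
  have hij : i < j := by simp only [i, j, Fin.mk_lt_mk]; omega
  have h1 := hmono hij
  have hd := dynRange_le m {i}
  have hprod : (∏ k ∈ {i}, m k) * ∏ k ∈ ({i} : Finset (Fin K))ᶜ, m k = ∏ k, m k :=
    Finset.prod_mul_prod_compl _ _
  have hj : m j ≤ ∏ k ∈ ({i} : Finset (Fin K))ᶜ, m k :=
    Finset.single_le_prod' (fun k _ => hpos k) (by simpa using hij.ne')
  rw [Finset.prod_singleton] at hd hprod
  rw [← hprod]
  generalize (∏ k ∈ ({i} : Finset (Fin K))ᶜ, m k) = b at *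
  constructor <;> nlinarith

lemma natCast_prod_dvd {K : ℕ} {m : Fin K → ℕ}
    (hcop : ∀ i j, i ≠ j → Nat.Coprime (m i) (m j)) (I : Finset (Fin K)) {z : ℤ}
    (h : ∀ k ∈ I, (m k : ℤ) ∣ z) : ((∏ k ∈ I, m k : ℕ) : ℤ) ∣ z := by
  rw [Nat.cast_prod]
  exact Finset.prod_dvd_of_coprime
    (fun i _ j _ hij => Nat.isCoprime_iff_coprime.2 (hcop i j hij)) h

/-- Uniqueness in the generalized Chinese remainder theorem for two integers. -/
lemma eq_or_eq_swap_of_residues {K : ℕ} (hK : 2 ≤ K) (m : Fin K → ℕ) (hpos : ∀ k, 0 < m k)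
    (hmono : StrictMono m) (hcop : ∀ i j, i ≠ j → Nat.Coprime (m i) (m j))
    (hthree : 3 ≤ m ⟨K - 2, by omega⟩) {a b a' b' : ℤ}
    (ha : 0 ≤ a ∧ a < dynRange m) (hb : 0 ≤ b ∧ b < dynRange m)
    (ha' : 0 ≤ a' ∧ a' < dynRange m) (hb' : 0 ≤ b' ∧ b' < dynRange m)
    (h : ∀ k, s((a : ZMod (m k)), (b : ZMod (m k))) =
      s((a' : ZMod (m k)), (b' : ZMod (m k)))) :
    (a = a' ∧ b = b') ∨ (a = b' ∧ b = a') := by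
  classical
  obtain ⟨hdP, hdP'⟩ := two_mul_dynRange_le hK m hpos hmono hthree
  have h' : ∀ k, ((m k : ℤ) ∣ a - a' ∧ (m k : ℤ) ∣ b - b') ∨
      ((m k : ℤ) ∣ a - b' ∧ (m k : ℤ) ∣ b - a') := by
    intro k
    have hc : ∀ u v : ℤ, (u : ZMod (m k)) = v → (m k : ℤ) ∣ u - v := fun u v huv =>
      (ZMod.intCast_eq_intCast_iff_dvd_sub v u (m k)).1 huv.symm
    exact (Sym2.eq_iff.1 (h k)).imp (fun h => ⟨hc _ _ h.1, hc _ _ h.2⟩)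
      fun h => ⟨hc _ _ h.1, hc _ _ h.2⟩
  have key : ∀ z : ℤ, z ≠ 0 → (∀ k, (m k : ℤ) ∣ z) → (∏ k, m k : ℕ) ≤ |z| := fun z hz hd =>
    Int.le_of_dvd (abs_pos.2 hz) ((dvd_abs _ _).2 (natCast_prod_dvd hcop _ fun k _ => hd k))
  set I : Finset (Fin K) :=
    Finset.univ.filter fun k => (m k : ℤ) ∣ a - a' ∧ (m k : ℤ) ∣ b - b'
  have keyI : ∀ z : ℤ, z ≠ 0 → (∀ k ∈ I, (m k : ℤ) ∣ z) → (∏ k ∈ I, m k : ℕ) ≤ |z| :=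
    fun z hz hd => Int.le_of_dvd (abs_pos.2 hz) ((dvd_abs _ _).2 (natCast_prod_dvd hcop _ hd))
  have keyJ : ∀ z : ℤ, z ≠ 0 → (∀ k ∈ Iᶜ, (m k : ℤ) ∣ z) → (∏ k ∈ Iᶜ, m k : ℕ) ≤ |z| :=
    fun z hz hd => Int.le_of_dvd (abs_pos.2 hz) ((dvd_abs _ _).2 (natCast_prod_dvd hcop _ hd))
  have hI : ∀ k ∈ I, (m k : ℤ) ∣ a - a' ∧ (m k : ℤ) ∣ b - b' := fun k hk => by
    simpa [I] using hk
  have hJ : ∀ k ∈ Iᶜ, (m k : ℤ) ∣ a - b' ∧ (m k : ℤ) ∣ b - a' := fun k hk => by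
    have hk' : ¬ ((m k : ℤ) ∣ a - a' ∧ (m k : ℤ) ∣ b - b') := by simpa [I] using hk
    exact (h' k).resolve_left hk'
  have hd := dynRange_le m I
  have h1 : a - a' ≠ 0 → _ := fun hz => keyI _ hz fun k hk => (hI k hk).1
  have h2 : b - b' ≠ 0 → _ := fun hz => keyI _ hz fun k hk => (hI k hk).2
  have h3 : a - b' ≠ 0 → _ := fun hz => keyJ _ hz fun k hk => (hJ k hk).1
  have h4 : b - a' ≠ 0 → _ := fun hz => keyJ _ hz fun k hk => (hJ k hk).2
  -- The sum of the pair is determined modulo every `m k`, whichever way the residues match.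
  have h5 : a + b - a' - b' ≠ 0 → _ := fun hz => key _ hz fun k => by
    rcases h' k with h | h
    · have := dvd_add h.1 h.2
      rwa [show a - a' + (b - b') = a + b - a' - b' by ring] at this
    · have := dvd_add h.1 h.2
      rwa [show a - b' + (b - a') = a + b - a' - b' by ring] at this
  have h6 : a = a' → b - b' ≠ 0 → _ := fun he hz => key _ hz fun k => by
    subst he
    rcases h' k with h | h
    · exact h.2
    · have := dvd_add h.1 h.2
      rwa [show a - b' + (b - a) = b - b' by ring] at this
  have h7 : b = b' → a - a' ≠ 0 → _ := fun he hz => key _ hz fun k => by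
    subst he
    rcases h' k with h | h
    · exact h.1
    · have := dvd_add h.1 h.2
      rwa [show a - b + (b - a') = a - a' by ring] at this
  have h8 : a = b' → b - a' ≠ 0 → _ := fun he hz => key _ hz fun k => by
    subst he
    rcases h' k with h | h
    · have := dvd_add h.1 h.2
      rwa [show a - a' + (b - a) = b - a' by ring] at this
    · exact h.2
  have h9 : b = a' → a - b' ≠ 0 → _ := fun he hz => key _ hz fun k => by
    subst he
    rcases h' k with h | h
    · have := dvd_add h.1 h.2
      rwa [show a - b + (b - b') = a - b' by ring] at this
    · exact h.1
  have h10 : a = b → a' = b' → a - a' ≠ 0 → _ := fun he he' hz => key _ hz fun k => by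
    subst he he'
    rcases h' k with h | h <;> exact h.1
  clear key keyI keyJ hI hJ h h'
  generalize (∏ k ∈ I, m k) = PI at *
  generalize (∏ k ∈ Iᶜ, m k) = PJ at *
  generalize (∏ k, m k) = P at *
  generalize dynRange m = d at *
  -- If the sums agree but the pairs do not, two differences from one extreme element add up to `PI
  -- + PJ ≥ d`, while they add up to at most `|a - b| < d`. If the sums differ, then by `h5` and `2
  -- * d ≤ P + 2` one pair is `(d - 1, d - 1)` and the other `(0, 0)`, which `h10` excludes.
  simp only [le_abs] at *
  omega

/-! ### Sorted common remainders and their quasiperiodic extension -/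

lemma rem_nonneg {M : ℝ} (hM : 0 < M) (x : ℝ) : 0 ≤ rem M x := by
  have h := Int.floor_le (x / M)
  rw [le_div_iff₀ hM] at h
  unfold rem
  linarith

lemma rem_lt {M : ℝ} (hM : 0 < M) (x : ℝ) : rem M x < M := by
  have h := Int.lt_floor_add_one (x / M)
  rw [div_lt_iff₀ hM] at h
  unfold rem
  linarith

/-- The sorted common remainders list the points along a bijection. -/
lemma exists_equiv_sortedRem {K : ℕ} (M : ℝ) (x : Fin 2 → Fin K → ℝ) :
    ∃ e : Fin 2 × Fin K ≃ Fin (2 * K),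
      (∀ p, sortedRem M x (e p + 1) = rem M (x p.1 p.2)) ∧
      Monotone fun i : Fin (2 * K) => sortedRem M x (i + 1) := by
  classical
  let φ : Fin 2 × Fin K ≃ Fin (2 * K) := finProdFinEquiv
  let g : Fin (2 * K) → ℝ := fun i => rem M (x (φ.symm i).1 (φ.symm i).2)
  let σ := Tuple.sort g
  have hσ : Monotone (g ∘ σ) := Tuple.monotone_sort g
  have hlist : (commonRems M x).sort (· ≤ ·) = List.ofFn (g ∘ σ) := by
    refine List.Perm.eq_of_pairwise' (r := (· ≤ ·)) (Multiset.pairwise_sort _ _) ?_ ?_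
    · exact (List.sortedLE_ofFn_iff.2 hσ).pairwise
    · rw [← Multiset.coe_eq_coe, Multiset.sort_eq, commonRems]
      have h1 : (List.ofFn (g ∘ σ) : Multiset ℝ) = Finset.univ.val.map (g ∘ σ) := by
        simp [List.ofFn_eq_map, Fin.univ_val_map, Function.comp_def]
      rw [h1]
      have h2 := congrArg Finset.val (Finset.map_univ_equiv (φ.trans σ.symm))
      rw [← h2, Finset.map_val, Multiset.map_map]
      refine Multiset.map_congr rfl fun p _ => ?_
      simp [g]
  have hs : ∀ i : Fin (2 * K), sortedRem M x (i + 1) = g (σ i) := by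
    intro i
    simp [sortedRem, hlist]
  refine ⟨φ.trans σ.symm, fun p => ?_, ?_⟩
  · rw [hs]; simp [g]
  · simp only [hs]; exact hσ

/-- The quasiperiodic extension of the sorted common remainders to all integer indices. -/
noncomputable def extRem {K : ℕ} (M : ℝ) (x : Fin 2 → Fin K → ℝ) (i : ℤ) : ℝ :=
  sortedRem M x (((i - 1) % (2 * K)).toNat + 1) + M * ((i - 1) / (2 * K) : ℤ)

section
variable {K : ℕ} {M : ℝ} {x : Fin 2 → Fin K → ℝ}

lemma extRem_add_period (hK : 0 < K) (i : ℤ) :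
    extRem M x (i + 2 * K) = extRem M x i + M := by
  have h : i + 2 * K - 1 = (i - 1) + 2 * K := by ring
  have h0 : (2 * K : ℤ) ≠ 0 := by omega
  rw [extRem, extRem, h, Int.add_emod_right, Int.add_ediv_of_dvd_right dvd_rfl, Int.ediv_self h0]
  push_cast
  ring

lemma extRem_natCast {i : ℕ} (h1 : 1 ≤ i) (h2 : i ≤ 2 * K) :
    extRem M x i = sortedRem M x i := by
  rw [extRem, Int.emod_eq_of_lt (by omega) (by omega), Int.ediv_eq_zero_of_lt (by omega) (by omega),
    show ((i : ℤ) - 1).toNat + 1 = i by omega]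
  simp

lemma sortedRem_mem (hM : 0 < M) {i : ℕ} (h1 : 1 ≤ i) (h2 : i ≤ 2 * K) :
    0 ≤ sortedRem M x i ∧ sortedRem M x i < M := by
  obtain ⟨e, he, -⟩ := exists_equiv_sortedRem M x
  have := he (e.symm ⟨i - 1, by omega⟩)
  simp only [Equiv.apply_symm_apply, Nat.sub_add_cancel h1] at this
  rw [this]
  exact ⟨rem_nonneg hM _, rem_lt hM _⟩

lemma extRem_monotone (hK : 0 < K) (hM : 0 < M) : Monotone (extRem M x) := by
  refine monotone_int_of_le_succ fun i => ?_
  have h0 : (0 : ℤ) < 2 * K := by omega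
  have hdec := Int.emod_add_mul_ediv (i - 1) (2 * K)
  have hn := Int.emod_nonneg (i - 1) h0.ne'
  have hl := Int.emod_lt_of_pos (i - 1) h0
  obtain ⟨r, hr⟩ := Int.eq_ofNat_of_zero_le hn
  set q := (i - 1) / (2 * K) with hq
  rw [extRem, extRem, hr, ← hq]
  by_cases hlt : r + 1 < 2 * K
  · have e1 : (i + 1 - 1) % (2 * K : ℤ) = (r + 1 : ℕ) := by
      rw [show i + 1 - 1 = ((r + 1 : ℕ) : ℤ) + 2 * K * q by push_cast; linarith,
        Int.add_mul_emod_self_left, Int.emod_eq_of_lt (by omega) (by omega)]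
    have e2 : (i + 1 - 1) / (2 * K : ℤ) = q := by
      rw [show i + 1 - 1 = ((r + 1 : ℕ) : ℤ) + 2 * K * q by push_cast; linarith,
        Int.add_mul_ediv_left _ _ h0.ne', Int.ediv_eq_zero_of_lt (by omega) (by omega), zero_add]
    rw [e1, e2]
    obtain ⟨e, -, hm⟩ := exists_equiv_sortedRem M x
    have := hm (a := ⟨r, by omega⟩) (b := ⟨r + 1, hlt⟩) (by simp [Fin.le_def])
    simpa using this
  -- At the wrap-around, monotonicity holds because all remainders lie in `[0, M)`.
  · have e1 : (i + 1 - 1) % (2 * K : ℤ) = (0 : ℕ) := by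
      rw [show i + 1 - 1 = (2 * K : ℤ) * (q + 1) by linarith [show (r : ℤ) + 1 = 2 * K by omega]]
      simp
    have e2 : (i + 1 - 1) / (2 * K : ℤ) = q + 1 := by
      rw [show i + 1 - 1 = (2 * K : ℤ) * (q + 1) by linarith [show (r : ℤ) + 1 = 2 * K by omega],
        Int.mul_ediv_cancel_left _ h0.ne']
    rw [e1, e2]
    have h1 := sortedRem_mem (x := x) (i := r + 1) hM (by omega) (by omega)
    have h2 := sortedRem_mem (x := x) (i := 1) hM (by omega) (by omega)
    simp only [Int.toNat_natCast, zero_add]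
    push_cast
    linarith [h1.2, h2.1]

lemma gap_eq {i : ℕ} (h1 : 1 ≤ i) (h2 : i ≤ 2 * K) :
    gap M x i = extRem M x (i + 1) - extRem M x i := by
  have hK : 0 < K := by omega
  unfold gap
  split_ifs with h
  · rw [← extRem_natCast h1 h2, ← extRem_natCast (by omega) (by omega)]
    push_cast
    rfl
  · obtain rfl : i = 2 * K := by omega
    rw [← extRem_natCast (le_refl 1) (by omega), ← extRem_natCast h1 h2]
    have := extRem_add_period (M := M) (x := x) hK 1
    push_cast
    rw [add_comm (2 * (K : ℤ)) 1, this]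
    ring

lemma omega_eq {k₀ j : ℕ} (hk : k₀ ≤ K) (h1 : 1 ≤ j) (h2 : j ≤ K) :
    omega M x k₀ j = extRem M x (k₀ + j) := by
  rw [omega, ← extRem_natCast (by omega) (by omega)]
  push_cast
  rfl

lemma upsilon_eq {k₀ j : ℕ} (hk : k₀ ≤ K) (h1 : 1 ≤ j) (h2 : j ≤ K) :
    upsilon M x k₀ j = extRem M x (k₀ - K + j) := by
  unfold upsilon
  split_ifs with h
  · rw [← extRem_natCast (by omega) (by omega)]
    have := extRem_add_period (M := M) (x := x) (by omega) (k₀ - K + j)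
    rw [show (k₀ : ℤ) - K + j + 2 * K = ((k₀ + K + j : ℕ) : ℤ) by push_cast; ring] at this
    linarith
  · rw [← extRem_natCast (by omega) (by omega)]
    congr 1
    omega

end
-- Two classes of points in a window of `2K` indices
section
variable {K : ℕ}

lemma exists_add_card_le {g : Fin K → ℤ} (hg : Function.Injective g) (hK : 0 < K) {a : ℤ}
    (h : ∀ k, a < g k) : ∃ k, a + K ≤ g k := by
  by_contra! hlt
  have := Finset.card_le_card (s := Finset.univ.image g) (t := Finset.Ioo a (a + K)) (by
    intro i hi
    obtain ⟨k, -, rfl⟩ := Finset.mem_image.1 hi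
    exact Finset.mem_Ioo.2 ⟨h k, hlt k⟩)
  rw [Finset.card_image_of_injective _ hg, Finset.card_univ, Fintype.card_fin, Int.card_Ioo] at this
  omega

lemma exists_le_sub_card {g : Fin K → ℤ} (hg : Function.Injective g) (hK : 0 < K) {a : ℤ}
    (h : ∀ k, g k < a) : ∃ k, g k ≤ a - K := by
  obtain ⟨k, hk⟩ := exists_add_card_le (g := fun k => -g k) (a := -a)
    (fun _ _ h => hg (neg_injective h)) hK (fun k => neg_lt_neg (h k))
  exact ⟨k, by linarith⟩

/-- If `K` distinct indices fill a window of length `K`, no other index falls into it. -/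
lemma exists_eq_of_window {g : Fin K → ℤ} (hg : Function.Injective g) {a : ℤ}
    (h : ∀ k, a < g k ∧ g k ≤ a + K) {i : ℤ} (h1 : a < i) (h2 : i ≤ a + K) : ∃ k, g k = i := by
  have hsub : Finset.univ.image g ⊆ Finset.Ioc a (a + K) := by
    intro i hi
    obtain ⟨k, -, rfl⟩ := Finset.mem_image.1 hi
    exact Finset.mem_Ioc.2 (h k)
  have heq := Finset.eq_of_subset_of_card_le hsub (by
    rw [Finset.card_image_of_injective _ hg, Finset.card_univ, Fintype.card_fin, Int.card_Ioc]
    omega)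
  have : i ∈ Finset.univ.image g := by rw [heq]; exact Finset.mem_Ioc.2 ⟨h1, h2⟩
  obtain ⟨k, -, hk⟩ := Finset.mem_image.1 this
  exact ⟨k, hk⟩

variable {M τ : ℝ} {A : ℤ → ℝ} {f : Fin 2 → Fin K → ℤ} {b : ℤ} {n : Fin 2 → ℝ}
  {δ : Fin 2 → Fin K → ℝ} {S : Fin 2 → Fin K → ℤ}

lemma exists_index_eq (hinj : Function.Injective (Function.uncurry f))
    (hf : ∀ l k, b < f l k ∧ f l k ≤ b + 2 * K) {i : ℤ} (h1 : b < i) (h2 : i ≤ b + 2 * K) :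
    ∃ l k, f l k = i := by
  obtain ⟨j, hj⟩ := exists_eq_of_window (K := 2 * K)
    (g := Function.uncurry f ∘ (finProdFinEquiv (m := 2) (n := K)).symm)
    (hinj.comp (Equiv.injective _)) (a := b) (fun j => by
      simpa [Function.uncurry] using hf _ _) h1 (by push_cast; exact h2)
  exact ⟨_, _, hj⟩

lemma injective_row (hinj : Function.Injective (Function.uncurry f)) (l : Fin 2) :
    Function.Injective (f l) := fun k k' h => by
  have := hinj (a₁ := (l, k)) (a₂ := (l, k')) h
  simpa using this

lemma index_ne (hinj : Function.Injective (Function.uncurry f)) {l l' : Fin 2} (h : l ≠ l')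
    (k k' : Fin K) : f l k ≠ f l' k' := fun he => by
  have := hinj (a₁ := (l, k)) (a₂ := (l', k')) he
  simp only [Prod.mk.injEq] at this
  exact h this.1

/-- The lower half of sorted points from two classes stays near the smaller centre, and the upper
half near the larger one. -/
lemma halves_near_centers (hK : 0 < K) (hA : Monotone A)
    (hinj : Function.Injective (Function.uncurry f))
    (hf : ∀ l k, b < f l k ∧ f l k ≤ b + 2 * K)
    (hAf : ∀ l k, A (f l k) = n l + δ l k) (hδ : ∀ l k, |δ l k| ≤ τ)
    {l₁ l₂ : Fin 2} (hl : ∀ l, l = l₁ ∨ l = l₂) (hn : n l₁ ≤ n l₂) :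
    (∀ i, b < i → i ≤ b + K → |A i - n l₁| ≤ τ) ∧
      ∀ i, b + K < i → i ≤ b + 2 * K → |A i - n l₂| ≤ τ := by
  have hbd : ∀ i, b < i → i ≤ b + 2 * K → n l₁ - τ ≤ A i ∧ A i ≤ n l₂ + τ := by
    intro i h1 h2
    obtain ⟨l, k, rfl⟩ := exists_index_eq hinj hf h1 h2
    have := abs_le.1 (hδ l k)
    rw [hAf]
    rcases hl l with rfl | rfl <;> constructor <;> linarith
  -- By counting, the class of the smaller centre reaches index `b + K` or beyond, which bounds the
  -- whole lower half from above; dually for `k₂`.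
  obtain ⟨k₁, hk₁⟩ := exists_add_card_le (injective_row hinj l₁) hK (fun k => (hf l₁ k).1)
  obtain ⟨k₂, hk₂⟩ := exists_le_sub_card (injective_row hinj l₂) hK (a := b + 2 * K + 1)
    (fun k => by linarith [(hf l₂ k).2])
  constructor
  · intro i h1 h2
    have h3 := hA (h2.trans hk₁)
    rw [hAf] at h3
    have := abs_le.1 (hδ l₁ k₁)
    have := hbd i h1 (by omega)
    exact abs_le.2 ⟨by linarith, by linarith⟩
  · intro i h1 h2
    have h3 := hA (show f l₂ k₂ ≤ i by omega)
    rw [hAf] at h3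
    have := abs_le.1 (hδ l₂ k₂)
    have := hbd i (by omega) h2
    exact abs_le.2 ⟨by linarith, by linarith⟩

/-- If the window starts at the lowest index of a point, each half has length at most `2τ`, so the
two gaps around the halves share at least `M - 4τ > M/2`. -/
lemma exists_large_gap_pair (hK : 0 < K) (hA : Monotone A)
    (hper : ∀ i, A (i + 2 * K) = A i + M) (hinj : Function.Injective (Function.uncurry f))
    (hAf : ∀ l k, A (f l k) = n l + δ l k) (hδ : ∀ l k, |δ l k| ≤ τ) (hτ : τ < M / 8)
    (hn : |n 0 - n 1| ≤ M / 2) :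
    ∃ b : ℤ, M / 2 < A (b + 1) - A b + (A (b + K + 1) - A (b + K)) := by
  have : Nonempty (Fin K) := ⟨⟨0, hK⟩⟩
  obtain ⟨p, hp⟩ := Finite.exists_min (Function.uncurry f)
  have hn' := abs_le.1 hn
  have hM : 0 ≤ M := by linarith [abs_nonneg (n 0 - n 1)]
  have hnn : ∀ l l', n l - n l' ≤ M / 2 := by
    simp only [Fin.forall_fin_two]
    refine ⟨⟨?_, ?_⟩, ?_, ?_⟩ <;> linarith
  set b : ℤ := f p.1 p.2 - 1 with hb
  have hb1 : f p.1 p.2 = b + 1 := by omega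
  have hf : ∀ l k, b < f l k ∧ f l k ≤ b + 2 * K := by
    intro l k
    have h1 := hp (l, k)
    simp only [Function.uncurry] at h1
    refine ⟨by omega, ?_⟩
    by_contra! hlt
    have h2 := hA (show b + 1 + 2 * K ≤ f l k by omega)
    rw [hper, ← hb1, hAf, hAf] at h2
    have := hnn l p.1
    have := abs_le.1 (hδ l k)
    have := abs_le.1 (hδ p.1 p.2)
    linarith
  have key : ∀ l₁ l₂ : Fin 2, (∀ l, l = l₁ ∨ l = l₂) → n l₁ ≤ n l₂ →
      M / 2 < A (b + 1) - A b + (A (b + K + 1) - A (b + K)) := by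
    intro l₁ l₂ hl hle
    obtain ⟨h1, h2⟩ := halves_near_centers hK hA hinj hf hAf hδ hl hle
    have e1 := abs_le.1 (h1 (b + 1) (by omega) (by omega))
    have e2 := abs_le.1 (h1 (b + K) (by omega) (by omega))
    have e3 := abs_le.1 (h2 (b + K + 1) (by omega) (by omega))
    have e4 := abs_le.1 (h2 (b + 2 * K) (by omega) (by omega))
    have := hper b
    linarith
  refine ⟨b, ?_⟩
  rcases le_total (n 0) (n 1) with h | h
  · exact key 0 1 (by decide) h
  · exact key 1 0 (by decide) h

/-- Two points of one class differ by at most `2 τ` modulo `M`. -/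
lemma exists_sub_sub_mul_le (hδ : ∀ l k, |δ l k| ≤ τ)
    (hS : ∀ l k, n l + δ l k = M * S l k + A (f l k)) (l : Fin 2) (k k' : Fin K) :
    |A (f l k) - A (f l k') - M * (S l k' - S l k : ℤ)| ≤ 2 * τ := by
  have h1 := hS l k
  have h2 := hS l k'
  have h3 := abs_le.1 (hδ l k)
  have h4 := abs_le.1 (hδ l k')
  push_cast
  exact abs_le.2 ⟨by linarith, by linarith⟩

/-- Either all points lie in an interval of length `4 τ`, or no class has points in both halves. -/
lemma range_le_or_pure (hK : 0 < K) (hA : Monotone A)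
    (hper : ∀ i, A (i + 2 * K) = A i + M) (hinj : Function.Injective (Function.uncurry f))
    (hf : ∀ l k, b < f l k ∧ f l k ≤ b + 2 * K)
    (hδ : ∀ l k, |δ l k| ≤ τ) (hτ : τ < M / 8)
    (hS : ∀ l k, n l + δ l k = M * S l k + A (f l k))
    (hG : M / 2 < A (b + 1) - A b + (A (b + K + 1) - A (b + K)))
    (hg : A (b + K + 1) - A (b + K) ≤ M / 2) :
    A (b + 2 * K) - A (b + 1) ≤ 4 * τ ∨ ∀ l, (∀ k, f l k ≤ b + K) ∨ ∀ k, b + K < f l k := by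
  by_contra! hcon
  obtain ⟨hlong, l₀, ⟨k₁, hk₁⟩, k₂, hk₂⟩ := hcon
  have hτ0 : 0 ≤ τ := (abs_nonneg _).trans (hδ 0 ⟨0, hK⟩)
  have hpb := hper b
  -- A class confined to one half would fill it, leaving no room there for `l₀`.
  have mixed : ∀ l, (∃ k, f l k ≤ b + K) ∧ ∃ k, b + K < f l k := by
    intro l
    by_cases hl : l₀ = l
    · subst hl
      exact ⟨⟨k₂, hk₂⟩, k₁, hk₁⟩
    constructor
    · by_contra! h
      obtain ⟨k, hk⟩ := exists_eq_of_window (injective_row hinj l) (a := b + K)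
        (fun k => ⟨h k, by linarith [(hf l k).2]⟩) hk₁ (by linarith [(hf l₀ k₁).2])
      exact index_ne hinj hl _ _ hk.symm
    · by_contra! h
      obtain ⟨k, hk⟩ := exists_eq_of_window (injective_row hinj l) (a := b)
        (fun k => ⟨(hf l k).1, h k⟩) (hf l₀ k₂).1 hk₂
      exact index_ne hinj hl _ _ hk.symm
  have dich : ∀ l k k', A (f l k') - A (f l k) ≤ 2 * τ ∨
      M - 2 * τ ≤ A (f l k') - A (f l k) := by
    intro l k k'
    have h1 := abs_le.1 (exists_sub_sub_mul_le hδ hS l k' k)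
    set z := S l k - S l k'
    rcases le_or_gt z 0 with hz | hz
    · left
      have hz' : (z : ℝ) ≤ 0 := by exact_mod_cast hz
      nlinarith
    · right
      have hz' : (1 : ℝ) ≤ z := by exact_mod_cast hz
      nlinarith
  have a1 := hA (show b + 1 ≤ b + K by omega)
  have a2 := hA (show b + K + 1 ≤ b + 2 * K by omega)
  -- A class crossing the middle by at most `2τ` makes the middle gap small. The window is then
  -- shorter than `M - 2τ`, so every difference within a class is at most `2τ`.
  by_cases hsmall : ∃ l k k', f l k ≤ b + K ∧ b + K < f l k' ∧ A (f l k') - A (f l k) ≤ 2 * τ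
  · obtain ⟨l, k, k', hk, hk', hle⟩ := hsmall
    have b1 := hA hk
    have b2 := hA (show b + K + 1 ≤ f l k' by omega)
    have all : ∀ l k k', A (f l k') - A (f l k) ≤ 2 * τ := by
      intro l k k'
      rcases dich l k k' with h | h
      · exact h
      · have c1 := hA (show b + 1 ≤ f l k from (hf l k).1)
        have c2 := hA (hf l k').2
        linarith
    obtain ⟨l₁, j₁, h₁⟩ := exists_index_eq hinj hf (i := b + 1) (by omega) (by omega)
    obtain ⟨l₂, j₂, h₂⟩ := exists_index_eq hinj hf (i := b + 2 * K) (by omega) (by omega)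
    obtain ⟨j₁', h₁'⟩ := (mixed l₁).2
    obtain ⟨j₂', h₂'⟩ := (mixed l₂).1
    have d1 := all l₁ j₁ j₁'
    have d2 := all l₂ j₂' j₂
    have d3 := hA (show b + K + 1 ≤ f l₁ j₁' by omega)
    have d4 := hA h₂'
    have d5 := hA (show b + K ≤ b + K + 1 by omega)
    rw [h₁] at d1
    rw [h₂] at d2
    linarith
  -- Otherwise all crossings are at least `M - 2τ`. Those from `b + K` and to `b + K + 1` add up to
  -- at most the window length plus the middle gap, hence to at most `3M/2 < 2M - 4τ`.
  · push Not at hsmall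
    obtain ⟨l₁, j₁, h₁⟩ := exists_index_eq hinj hf (i := b + K) (by omega) (by omega)
    obtain ⟨l₂, j₂, h₂⟩ := exists_index_eq hinj hf (i := b + K + 1) (by omega) (by omega)
    obtain ⟨j₁', h₁'⟩ := (mixed l₁).2
    obtain ⟨j₂', h₂'⟩ := (mixed l₂).1
    have d1 := (dich l₁ j₁ j₁').resolve_left (hsmall l₁ j₁ j₁' h₁.le h₁').not_ge
    have d2 := (dich l₂ j₂' j₂).resolve_left (hsmall l₂ j₂' j₂ h₂' (by omega)).not_ge
    have d3 := hA (hf l₁ j₁').2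
    have d4 := hA (show b + 1 ≤ f l₂ j₂' from (hf l₂ j₂').1)
    rw [h₁] at d1
    rw [h₂] at d2
    have d5 := hA (show b ≤ b + 1 by omega)
    linarith

/-- Within the window a class spans less than `M/2`, whereas different quotients would force a
difference of at least `M - 2τ`. -/
lemma quotient_const (hK : 0 < K) (hA : Monotone A)
    (hper : ∀ i, A (i + 2 * K) = A i + M) (hinj : Function.Injective (Function.uncurry f))
    (hf : ∀ l k, b < f l k ∧ f l k ≤ b + 2 * K)
    (hδ : ∀ l k, |δ l k| ≤ τ) (hτ : τ < M / 8)
    (hS : ∀ l k, n l + δ l k = M * S l k + A (f l k))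
    (hG : M / 2 < A (b + 1) - A b + (A (b + K + 1) - A (b + K)))
    (hg : A (b + K + 1) - A (b + K) ≤ M / 2) (l : Fin 2) (k k' : Fin K) :
    S l k = S l k' := by
  have hτ0 : 0 ≤ τ := (abs_nonneg _).trans (hδ l k)
  have hpb := hper b
  have a1 := hA (show b + 1 ≤ b + K by omega)
  have a2 := hA (show b + K + 1 ≤ b + 2 * K by omega)
  have hle : ∀ k k', A (f l k) - A (f l k') < M / 2 := by
    intro k k'
    have h1 := hA (hf l k).2
    have h2 := hA (show b + 1 ≤ f l k' from (hf l k').1)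
    rcases range_le_or_pure hK hA hper hinj hf hδ hτ hS hG hg with h | h
    · linarith
    · rcases h l with h | h
      · have := hA (h k)
        linarith
      · have := hA (show b + K + 1 ≤ f l k' from h k')
        linarith
  have h1 := abs_le.1 (exists_sub_sub_mul_le hδ hS l k k')
  have h2 := hle k k'
  have h3 := hle k' k
  rcases lt_trichotomy (S l k' - S l k) 0 with hz | hz | hz
  · have hz' : ((S l k' - S l k : ℤ) : ℝ) ≤ -1 := by exact_mod_cast Int.le_sub_one_of_lt hz
    nlinarith
  · omega
  · have hz' : (1 : ℝ) ≤ (S l k' - S l k : ℤ) := by exact_mod_cast hz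
    nlinarith

/-- This bound yields `s l < d`. The critical case is a class filling the lower half: the other
class fills the upper half, has spread at most `2τ` and a nonnegative top, and the middle gap costs
less than `M/2`. -/
lemma exists_representative_gt (hK : 0 < K) (hA : Monotone A)
    (hper : ∀ i, A (i + 2 * K) = A i + M) (hinj : Function.Injective (Function.uncurry f))
    (hf : ∀ l k, b < f l k ∧ f l k ≤ b + 2 * K)
    (hδ : ∀ l k, |δ l k| ≤ τ) (hτ : τ < M / 8)
    (hS : ∀ l k, n l + δ l k = M * S l k + A (f l k))
    (hG : M / 2 < A (b + 1) - A b + (A (b + K + 1) - A (b + K)))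
    (hg : A (b + K + 1) - A (b + K) ≤ M / 2) (hhigh : 0 ≤ A (b + 2 * K))
    (hlow : 0 ≤ A (b + K) ∨ A (b + K + 1) - A (b + K) < M / 2) (l : Fin 2) :
    ∃ k, -(M / 2) - 2 * τ < A (f l k) := by
  have hτ0 : 0 ≤ τ := (abs_nonneg _).trans (hδ 0 ⟨0, hK⟩)
  have hpb := hper b
  have a1 := hA (show b + 1 ≤ b + K by omega)
  have a2 := hA (show b + K + 1 ≤ b + 2 * K by omega)
  rcases range_le_or_pure hK hA hper hinj hf hδ hτ hS hG hg with h | h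
  · refine ⟨⟨0, hK⟩, ?_⟩
    have := hA (show b + 1 ≤ f l ⟨0, hK⟩ from (hf l _).1)
    linarith
  · rcases h l with hl | hl
    · obtain ⟨k, hk⟩ := exists_eq_of_window (injective_row hinj l) (a := b)
        (fun k => ⟨(hf l k).1, hl k⟩) (i := b + K) (by omega) le_rfl
      refine ⟨k, ?_⟩
      rw [hk]
      rcases hlow with hlow | hlow
      · linarith
      · have other : ∀ i, b + K < i → i ≤ b + 2 * K → ∃ k, f (1 - l) k = i := by
          intro i h1 h2
          obtain ⟨l', k', rfl⟩ := exists_index_eq hinj hf (by omega) h2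
          refine ⟨k', ?_⟩
          have : l' ≠ l := by
            rintro rfl
            exact absurd (hl k') (not_le.2 h1)
          have : 1 - l = l' := by omega
          rw [this]
        obtain ⟨j₁, h₁⟩ := other (b + K + 1) (by omega) (by omega)
        obtain ⟨j₂, h₂⟩ := other (b + 2 * K) (by omega) (by omega)
        have hs := quotient_const hK hA hper hinj hf hδ hτ hS hG hg (1 - l) j₂ j₁
        have := abs_le.1 (exists_sub_sub_mul_le hδ hS (1 - l) j₂ j₁)
        rw [hs, h₁, h₂] at this
        simp only [sub_self, Int.cast_zero, mul_zero, sub_zero] at this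
        linarith
    · refine ⟨⟨0, hK⟩, ?_⟩
      have := hA (show b + K + 1 ≤ f l ⟨0, hK⟩ from hl _)
      linarith

end

/-! ### Cluster representatives and the common quotients -/

lemma circDist_eq_zero_iff {M : ℝ} (hM : M ≠ 0) {u v : ℝ} :
    circDist M u v = 0 ↔ ∃ z : ℤ, u = v + M * z := by
  constructor
  · intro h
    refine ⟨round ((u - v) / M), ?_⟩
    unfold circDist at h
    linarith
  · rintro ⟨z, rfl⟩
    have : (v + M * z - v) / M = z := by field_simp; ring
    rw [circDist, this, round_intCast]
    ring

lemma exists_le_average {ι : Type*} {s : Finset ι} (hs : s.Nonempty) (g : ι → ℝ) :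
    ∃ j ∈ s, g j ≤ (∑ i ∈ s, g i) / s.card := by
  have h0 : (0 : ℝ) < s.card := by exact_mod_cast hs.card_pos
  refine Finset.exists_le_of_sum_le hs ?_
  rw [Finset.sum_const, nsmul_eq_mul]
  field_simp
  exact le_rfl

lemma exists_average_le {ι : Type*} {s : Finset ι} (hs : s.Nonempty) (g : ι → ℝ) :
    ∃ j ∈ s, (∑ i ∈ s, g i) / s.card ≤ g j := by
  obtain ⟨j, hj, h⟩ := exists_le_average hs fun i => -g i
  refine ⟨j, hj, ?_⟩
  rw [Finset.sum_neg_distrib, neg_div] at h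
  linarith

lemma abs_add_average_sub_le {ι : Type*} {s : Finset ι} (hs : s.Nonempty) (g : ι → ℝ) {a u τ : ℝ}
    (h : ∀ j ∈ s, |a + g j - u| ≤ τ) : |a + (∑ i ∈ s, g i) / s.card - u| ≤ τ := by
  obtain ⟨j, hj, h1⟩ := exists_le_average hs g
  obtain ⟨j', hj', h2⟩ := exists_average_le hs g
  have h3 := abs_le.1 (h j hj)
  have h4 := abs_le.1 (h j' hj')
  exact abs_le.2 ⟨by linarith, by linarith⟩

/-- The representative in `Ω'` of the `j`-th element of cluster `t`. -/
noncomputable def clusterRep {K : ℕ} (M : ℝ) (x : Fin 2 → Fin K → ℝ) (k₀ : ℕ) (t : Fin 2) (j : ℕ) :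
    ℝ :=
  if t = 0 then omega' M x k₀ j else upsilon M x k₀ j

section
variable {K : ℕ} {M : ℝ} {x : Fin 2 → Fin K → ℝ} {k₀ : ℕ}

lemma clusterMean_eq (t : Fin 2) :
    clusterMean M x k₀ t = (∑ j ∈ Finset.Icc 1 K, clusterRep M x k₀ t j) /
      (Finset.Icc 1 K).card := by
  rw [Nat.card_Icc, Nat.add_sub_cancel]
  rfl

lemma mem_omegaSet_iff {c : ℝ} :
    c ∈ omegaSet M x k₀ ↔ ∃ t, ∃ j ∈ Finset.Icc 1 K, c = clusterRep M x k₀ t j := by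
  rw [Fin.exists_fin_two]
  simp only [omegaSet, clusterRep, Set.mem_ofPred_eq, if_true, one_ne_zero, if_false]
  constructor
  · rintro ⟨j, hj, h | h⟩
    exacts [Or.inl ⟨j, hj, h⟩, Or.inr ⟨j, hj, h⟩]
  · rintro (⟨j, hj, h⟩ | ⟨j, hj, h⟩)
    exacts [⟨j, hj, Or.inl h⟩, ⟨j, hj, Or.inr h⟩]

lemma exists_cluster_eq (t : Fin 2) (j : ℕ) :
    ∃ z : ℤ, cluster M x k₀ t j = clusterRep M x k₀ t j + M * z := by
  unfold cluster clusterRep omega'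
  split_ifs
  · exact ⟨0, by simp⟩
  · exact ⟨1, by simp⟩
  · exact ⟨0, by simp⟩

lemma extRem_add_mul_period (hK : 0 < K) (i z : ℤ) :
    extRem M x (i + 2 * K * z) = extRem M x i + M * z := by
  have h0 : (2 * K : ℤ) ≠ 0 := by omega
  rw [extRem, extRem, show i + 2 * K * z - 1 = (i - 1) + 2 * K * z by ring,
    Int.add_mul_emod_self_left, Int.add_mul_ediv_left _ _ h0]
  push_cast
  ring

/-- The indices are distinct modulo `2 * K`, so they stay distinct after arbitrary shifts `z` by
periods; such shifts move points into a chosen window. -/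
lemma exists_index (π : Fin K → Equiv.Perm (Fin 2)) :
    ∃ e : Fin 2 → Fin K → ℤ, (∀ l k, extRem M x (e l k) = rem M (x (π k l) k)) ∧
      ∀ z : Fin 2 → Fin K → ℤ,
        Function.Injective (Function.uncurry fun l k => e l k + 2 * K * z l k) := by
  obtain ⟨e, he, -⟩ := exists_equiv_sortedRem M x
  refine ⟨fun l k => (e (π k l, k) : ℕ) + 1, fun l k => ?_, fun z => ?_⟩
  · rw [← he (π k l, k), ← extRem_natCast (by omega) (by omega)]
    push_cast
    rfl
  · rintro ⟨l, k⟩ ⟨l', k'⟩ h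
    simp only [Function.uncurry] at h
    have h1 : ((e (π k l, k) : ℕ) : ℤ) = (e (π k' l', k') : ℕ) := by
      have h2 : ((e (π k l, k) : ℕ) : ℤ) + 2 * K * z l k =
          (e (π k' l', k') : ℕ) + 2 * K * z l' k' := by linarith
      have h3 := congrArg (· % (2 * K : ℤ)) h2
      simp only [Int.add_mul_emod_self_left] at h3
      rwa [Int.emod_eq_of_lt (by omega) (by omega), Int.emod_eq_of_lt (by omega) (by omega)] at h3
    have h2 := e.injective (Fin.ext (by exact_mod_cast h1))
    simp only [Prod.mk.injEq] at h2
    obtain ⟨h3, rfl⟩ := h2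
    rw [(π k).injective h3]

/-- An index satisfying the requirement of the first step of the procedure exists. -/
lemma exists_gap_index (hK : 0 < K) (hM : 0 < M) {n : Fin 2 → ℝ} {δ : Fin 2 → Fin K → ℝ} {τ : ℝ}
    (hδ : ∀ l k, |δ l k| ≤ τ) (hτ : τ < M / 8)
    (hx : ∀ l k, ∃ z : ℤ, n l + δ l k = x l k + M * z) :
    ∃ k₀, 1 ≤ k₀ ∧ k₀ ≤ K ∧ M / 2 < gap M x k₀ + gap M x (k₀ + K) := by
  obtain ⟨e, he, hinj⟩ := exists_index (M := M) (x := x) fun _ => 1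
  choose z hz using hx
  -- Shifting `n 0` by the nearest multiple of `M` brings the centres within `M / 2`.
  let u : Fin 2 → ℤ := fun l => if l = 0 then -round ((n 0 - n 1) / M) else 0
  obtain ⟨b, hb⟩ := exists_large_gap_pair (M := M) (A := extRem M x)
    (n := fun l => n l + M * u l) (δ := δ) (τ := τ) hK (extRem_monotone hK hM)
    (extRem_add_period hK) (hinj fun l k => ⌊x l k / M⌋ + z l k + u l)
    (fun l k => by
      rw [extRem_add_mul_period hK, he, rem]
      push_cast
      simp only [id]
      linarith [hz l k]) hδ hτ (by
      have h := abs_sub_round ((n 0 - n 1) / M)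
      have h1 : n 0 + M * u 0 - (n 1 + M * u 1) =
          M * ((n 0 - n 1) / M - round ((n 0 - n 1) / M)) := by
        simp only [u, if_true, one_ne_zero, if_false]
        push_cast
        field_simp
        ring
      rw [h1, abs_mul, abs_of_pos hM]
      nlinarith)
  -- The sum of two opposite gaps has period `K`, so `b` can be moved into `1, …, K`.
  have hper : Function.Periodic (fun b : ℤ => extRem M x (b + 1) - extRem M x b +
      (extRem M x (b + K + 1) - extRem M x (b + K))) K := by
    intro i
    have h1 := extRem_add_period (M := M) (x := x) hK i
    have h2 := extRem_add_period (M := M) (x := x) hK (i + 1)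
    simp only
    rw [show i + K + K = i + 2 * (K : ℤ) by ring, h1,
      show i + 2 * (K : ℤ) + 1 = i + 1 + 2 * K by ring, h2]
    ring
  have hK' : (0 : ℤ) < K := by omega
  have hn := Int.emod_nonneg (b - 1) hK'.ne'
  have hl := Int.emod_lt_of_pos (b - 1) hK'
  have hdec := Int.emod_add_mul_ediv (b - 1) K
  obtain ⟨r, hr⟩ := Int.eq_ofNat_of_zero_le hn
  refine ⟨r + 1, by omega, by omega, ?_⟩
  rw [gap_eq (by omega) (by omega), gap_eq (by omega) (by omega)]
  have h := hper.int_mul ((b - 1) / K) ((r + 1 : ℕ) : ℤ)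
  have hbe : ((r + 1 : ℕ) : ℤ) + (b - 1) / K * K = b := by
    push_cast
    linarith [mul_comm ((b - 1) / (K : ℤ)) K]
  simp only [Int.cast_id, hbe] at h
  rw [h] at hb
  push_cast at hb ⊢
  exact hb

/-- The shifted clusters are the two halves of a window of `2 K` consecutive indices. -/
lemma exists_window (hM : 0 < M) (h1 : 1 ≤ k₀) (h2 : k₀ ≤ K)
    (hgap : M / 2 < gap M x k₀ + gap M x (k₀ + K)) :
    ∃ (b : ℤ) (σ : Equiv.Perm (Fin 2)),
      M / 2 < extRem M x (b + 1) - extRem M x b +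
        (extRem M x (b + K + 1) - extRem M x (b + K)) ∧
      extRem M x (b + K + 1) - extRem M x (b + K) ≤ M / 2 ∧
      0 ≤ extRem M x (b + 2 * K) ∧
      (0 ≤ extRem M x (b + K) ∨ extRem M x (b + K + 1) - extRem M x (b + K) < M / 2) ∧
      extRem M x (b + 2 * K) < M ∧
      ∀ t j, 1 ≤ j → j ≤ K → clusterRep M x k₀ t j = extRem M x (b + K * (σ t : ℕ) + j) := by
  have hK : 0 < K := by omega
  have hA := extRem_monotone (x := x) hK hM
  have hp : ∀ i i' : ℤ, i' = i + 2 * K → extRem M x i' = extRem M x i + M := by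
    rintro i _ rfl
    exact extRem_add_period hK i
  have r1 := sortedRem_mem (x := x) (i := k₀) hM h1 (by omega)
  have r2 := sortedRem_mem (x := x) (i := k₀ + K) hM (by omega) (by omega)
  rw [← extRem_natCast (by omega) (by omega)] at r1 r2
  rw [gap_eq h1 (by omega), gap_eq (by omega) (by omega)] at hgap
  push_cast at hgap r2
  have hdiff : omega M x k₀ K - upsilon M x k₀ 1 =
      extRem M x (k₀ + K) - extRem M x (k₀ - K + 1) := by
    rw [omega_eq h2 hK le_rfl, upsilon_eq h2 le_rfl hK]
    push_cast
    rfl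
  have p1 := hp (k₀ - K) (k₀ + K) (by ring)
  have p2 := hp (k₀ - K + 1) (k₀ + K + 1) (by ring)
  by_cases hc : omega M x k₀ K - upsilon M x k₀ 1 ≤ M / 2
  -- Unshifted case: `υ` is the lower half and `ω` the upper one.
  · refine ⟨k₀ - K, Equiv.swap 0 1, ?_, ?_, ?_, ?_, ?_, ?_⟩
    all_goals try simp only [sub_add_cancel, show (k₀ : ℤ) - K + 2 * K = k₀ + K by ring]
    · linarith
    · have := hA (show (k₀ : ℤ) - K + 1 ≤ k₀ by omega)
      have := hA (show (k₀ : ℤ) + 1 ≤ k₀ + K by omega)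
      linarith
    · exact r2.1
    · exact Or.inl r1.1
    · exact r2.2
    · intro t j hj1 hj2
      fin_cases t
      · simp [clusterRep, omega', hc, omega_eq h2 hj1 hj2]
      · simp [clusterRep, upsilon_eq h2 hj1 hj2]
  -- Shifted case: `ω'` precedes `υ`. The middle gap is `M` minus the old window length, which
  -- exceeds `M / 2`; hence the strict bound.
  · have p3 := hp (k₀ - 2 * K) k₀ (by ring)
    have p4 := hp (k₀ - 2 * K + 1) (k₀ + 1) (by ring)
    rw [hdiff] at hc
    refine ⟨k₀ - 2 * K, 1, ?_, ?_, ?_, ?_, ?_, ?_⟩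
    all_goals try simp only [sub_add_cancel, show (k₀ : ℤ) - 2 * K + K = k₀ - K by ring]
    · linarith
    · linarith
    · exact r1.1
    · right
      linarith
    · exact r1.2
    · intro t j hj1 hj2
      fin_cases t
      · have := hp (k₀ - 2 * K + j) (k₀ + j) (by ring)
        simp [clusterRep, omega', hdiff, hc, omega_eq h2 hj1 hj2, this]
      · simp [clusterRep, upsilon_eq h2 hj1 hj2]
        ring_nf

/-- Every valid choice of the clusters represents each `n l + δ l k` as `M s l + c l k` with
`c l k ∈ Ω'` and a quotient `s l` that does not depend on `k`. -/
lemma exists_quotient_representative (hM : 0 < M) (h1 : 1 ≤ k₀) (h2 : k₀ ≤ K)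
    (hgap : M / 2 < gap M x k₀ + gap M x (k₀ + K)) {n : Fin 2 → ℝ} {δ : Fin 2 → Fin K → ℝ} {τ : ℝ}
    (hδ : ∀ l k, |δ l k| ≤ τ) (hτ : τ < M / 8) (π : Fin K → Equiv.Perm (Fin 2))
    (hx : ∀ l k, ∃ z : ℤ, n l + δ l k = x (π k l) k + M * z) :
    ∃ (s : Fin 2 → ℤ) (c : Fin 2 → Fin K → ℝ),
      (∀ l k, n l + δ l k = M * s l + c l k) ∧ (∀ l k, c l k ∈ omegaSet M x k₀) ∧
      (∀ u ∈ omegaSet M x k₀, ∀ v ∈ omegaSet M x k₀, u - v < M) ∧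
      (∀ l k, c l k < M) ∧ (∀ l, ∃ k, -(M / 2) - 2 * τ < c l k) ∧
      (∀ t, ∀ j ∈ Finset.Icc 1 K, |clusterRep M x k₀ t j - clusterMean M x k₀ t| < M / 2) ∧
      (s 0 = s 1 → ∃ σ : Equiv.Perm (Fin 2),
        ∀ t, |M * s (σ t) + clusterMean M x k₀ t - n (σ t)| ≤ τ) := by
  have hK : 0 < K := by omega
  have hA := extRem_monotone (x := x) hK hM
  have hper := extRem_add_period (M := M) (x := x) hK
  obtain ⟨b, σ, hG, hg, hhigh, hlow, hlt, hrep⟩ := exists_window hM h1 h2 hgap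
  obtain ⟨e, he, hinj⟩ := exists_index (M := M) (x := x) π
  choose z hz using hx
  have hK2 : (0 : ℤ) < 2 * K := by omega
  let w : Fin 2 → Fin K → ℤ := fun l k => (e l k - (b + 1)) / (2 * K)
  let f : Fin 2 → Fin K → ℤ := fun l k => e l k + 2 * K * (-w l k)
  have hf : ∀ l k, b < f l k ∧ f l k ≤ b + 2 * K := by
    intro l k
    have e1 := Int.emod_nonneg (e l k - (b + 1)) hK2.ne'
    have e2 := Int.emod_lt_of_pos (e l k - (b + 1)) hK2
    have e3 := Int.emod_add_mul_ediv (e l k - (b + 1)) (2 * K)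
    simp only [f, w]
    constructor <;> linarith
  have hfi : Function.Injective (Function.uncurry f) := hinj _
  let S : Fin 2 → Fin K → ℤ := fun l k => z l k + ⌊x (π k l) k / M⌋ + w l k
  have hS : ∀ l k, n l + δ l k = M * S l k + extRem M x (f l k) := by
    intro l k
    simp only [f, S]
    rw [extRem_add_mul_period hK, he, rem, hz]
    push_cast
    ring
  clear_value f S
  have hconst := quotient_const hK hA hper hfi hf hδ hτ hS hG hg
  have hbp := hper b
  have hmem : ∀ u ∈ omegaSet M x k₀,
      extRem M x (b + 1) ≤ u ∧ u ≤ extRem M x (b + 2 * K) := by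
    intro u hu
    obtain ⟨t, j, hj, rfl⟩ := mem_omegaSet_iff.1 hu
    rw [Finset.mem_Icc] at hj
    rw [hrep t j hj.1 hj.2]
    have : (K : ℤ) * (σ t : ℕ) = 0 ∨ (K : ℤ) * (σ t : ℕ) = K := by
      have : (σ t : ℕ) = 0 ∨ (σ t : ℕ) = 1 := by omega
      rcases this with h | h <;> simp [h]
    constructor <;> apply hA <;> omega
  have hne : (Finset.Icc 1 K).Nonempty := Finset.nonempty_Icc.2 hK
  refine ⟨fun l => S l ⟨0, hK⟩, fun l k => extRem M x (f l k), fun l k => ?_, fun l k => ?_,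
    fun u hu v hv => ?_, fun l k => ?_, fun l => ?_, fun t j hj => ?_, fun hs => ?_⟩
  · rw [hS, hconst l k]
  · rw [mem_omegaSet_iff]
    rcases le_or_gt (f l k) (b + K) with h | h
    · refine ⟨σ.symm 0, (f l k - b).toNat, ?_, ?_⟩
      · rw [Finset.mem_Icc]
        have := hf l k
        omega
      · have := hf l k
        rw [hrep _ _ (by omega) (by omega)]
        refine congrArg _ ?_
        rw [Equiv.apply_symm_apply, Fin.val_zero]
        omega
    · refine ⟨σ.symm 1, (f l k - b - K).toNat, ?_, ?_⟩
      · rw [Finset.mem_Icc]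
        have := hf l k
        omega
      · have := hf l k
        rw [hrep _ _ (by omega) (by omega)]
        refine congrArg _ ?_
        rw [Equiv.apply_symm_apply, Fin.val_one]
        omega
  · have := hmem u hu
    have := hmem v hv
    have := hA (show b + K ≤ b + K + 1 by omega)
    linarith
  · exact (hA (hf l k).2).trans_lt hlt
  · exact exists_representative_gt hK hA hper hfi hf hδ hτ hS hG hg hhigh hlow l
  · have hspan : ∀ j ∈ Finset.Icc 1 K, ∀ j' ∈ Finset.Icc 1 K,
        clusterRep M x k₀ t j - clusterRep M x k₀ t j' < M / 2 := by
      intro j hj j' hj'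
      rw [Finset.mem_Icc] at hj hj'
      rw [hrep t j hj.1 hj.2, hrep t j' hj'.1 hj'.2]
      have a1 := hA (show b + 1 ≤ b + K by omega)
      have a2 := hA (show b + K + 1 ≤ b + 2 * K by omega)
      have : (σ t : ℕ) = 0 ∨ (σ t : ℕ) = 1 := by omega
      rcases this with h | h
      · have a3 := hA (show b + K * (σ t : ℕ) + j ≤ b + K by rw [h]; push_cast; omega)
        have a4 := hA (show b + 1 ≤ b + K * (σ t : ℕ) + j' by rw [h]; push_cast; omega)
        linarith
      · have a3 := hA (show b + K * (σ t : ℕ) + j ≤ b + 2 * K by rw [h]; push_cast; omega)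
        have a4 := hA (show b + K + 1 ≤ b + K * (σ t : ℕ) + j' by rw [h]; push_cast; omega)
        linarith
    rw [clusterMean_eq]
    obtain ⟨j₁, hj₁, g1⟩ := exists_le_average hne (clusterRep M x k₀ t)
    obtain ⟨j₂, hj₂, g2⟩ := exists_average_le hne (clusterRep M x k₀ t)
    have := hspan j hj j₁ hj₁
    have := hspan j₂ hj₂ j hj
    exact abs_lt.2 ⟨by linarith, by linarith⟩
  -- With equal quotients, subtracting `M * s` puts both classes around true centres, so each half
  -- averages to within `τ` of one of them; `ρ` orders the centres.
  · set s := S 0 ⟨0, hK⟩ with hs0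
    have hsl : ∀ l, S l ⟨0, hK⟩ = s := by
      rw [Fin.forall_fin_two]
      exact ⟨rfl, hs.symm⟩
    have key : ∀ ρ : Equiv.Perm (Fin 2), n (ρ 0) ≤ n (ρ 1) →
        ∀ t, |M * s + clusterMean M x k₀ t - n (ρ (σ t))| ≤ τ := by
      intro ρ hρ t
      obtain ⟨g1, g2⟩ := halves_near_centers (n := fun l => n l - M * s) (l₁ := ρ 0) (l₂ := ρ 1)
        hK hA hfi hf
        (fun l k => by
          have := hS l k
          rw [hconst l k ⟨0, hK⟩, hsl] at this
          linarith) hδ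
        (fun l => by
          have : ρ.symm l = 0 ∨ ρ.symm l = 1 := by omega
          rcases this with h | h <;> simp [← h]) (by linarith)
      rw [clusterMean_eq]
      refine abs_add_average_sub_le hne _ fun j hj => ?_
      rw [Finset.mem_Icc] at hj
      rw [hrep t j hj.1 hj.2]
      have : σ t = 0 ∨ σ t = 1 := by omega
      rcases this with h | h
      · have := g1 (b + K * (σ t : ℕ) + j) (by rw [h]; simp; omega) (by rw [h]; simp; omega)
        rw [h] at this ⊢
        convert this using 2
        ring
      · have := g2 (b + K * (σ t : ℕ) + j) (by rw [h]; simp; omega) (by rw [h]; simp; omega)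
        rw [h] at this ⊢
        convert this using 2
        ring
    simp only [hsl]
    rcases le_total (n 0) (n 1) with h | h
    · exact ⟨σ, key 1 h⟩
    · exact ⟨σ.trans (Equiv.swap 0 1), key (Equiv.swap 0 1) (by simpa using h)⟩

end

/-! ### From cluster representatives to residues of the quotients -/

lemma erroneousRem_eq {K : ℕ} (M : ℕ) (m : Fin K → ℕ) (N : Fin 2 → ℕ) (Δr : Fin 2 → Fin K → ℝ)
    (l : Fin 2) (k : Fin K) :
    (N l : ℝ) + Δr l k =
      erroneousRem M m N Δr l k + M * ((m k * (N l / (M * m k) : ℕ) : ℤ) : ℝ) := by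
  have h : ((N l % (M * m k) + M * m k * (N l / (M * m k)) : ℕ) : ℝ) = N l :=
    congrArg _ (Nat.mod_add_div _ _)
  rw [erroneousRem, ← h]
  generalize N l / (M * m k) = q
  push_cast
  ring

lemma sym2_mk_perm {α : Type*} (g : Fin 2 → α) (π : Equiv.Perm (Fin 2)) :
    s(g (π 0), g (π 1)) = s(g 0, g 1) := by
  have : π 0 = 0 ∧ π 1 = 1 ∨ π 0 = 1 ∧ π 1 = 0 := by
    have : π 0 ≠ π 1 := fun h => zero_ne_one (π.injective h)
    omega
  rcases this with h | h
  · rw [h.1, h.2]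
  · rw [h.1, h.2, Sym2.eq_swap]

lemma exists_perm_of_sym2_eq {α : Type*} {g h : Fin 2 → α} (H : s(g 0, g 1) = s(h 0, h 1)) :
    ∃ π : Equiv.Perm (Fin 2), ∀ l, g l = h (π l) := by
  rcases Sym2.eq_iff.1 H with H | H
  · exact ⟨1, Fin.forall_fin_two.2 H⟩
  · exact ⟨Equiv.swap 0 1, Fin.forall_fin_two.2 (by simpa using H)⟩

section
variable {K : ℕ} {M : ℝ} {x : Fin 2 → Fin K → ℝ} {k₀ : ℕ}

/-- The rounded quotient of a remainder with representative `c` recovers the quotient modulo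
`m k`, whichever admissible cluster is chosen. -/
lemma qhat_modEq (hM : 0 < M) {t : Fin 2 → Fin K → Fin 2} {l : Fin 2} {k : Fin K} {c : ℝ}
    {s v μ : ℤ}
    (hc : c ∈ omegaSet M x k₀)
    (hrange : ∀ u ∈ omegaSet M x k₀, ∀ v ∈ omegaSet M x k₀, u - v < M)
    (hmean : ∀ t, ∀ j ∈ Finset.Icc 1 K,
      |clusterRep M x k₀ t j - clusterMean M x k₀ t| < M / 2)
    (ht : ∃ j ∈ Finset.Icc 1 K, circDist M (rem M (x l k)) (cluster M x k₀ (t l k) j) = 0)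
    (hx : x l k + M * ((μ * v : ℤ) : ℝ) = M * s + c) :
    qhat M x k₀ t l k ≡ s [ZMOD μ] := by
  obtain ⟨j, hj, h⟩ := ht
  obtain ⟨z, hz⟩ := (circDist_eq_zero_iff hM.ne').1 h
  obtain ⟨z', hz'⟩ := exists_cluster_eq (M := M) (x := x) (k₀ := k₀) (t l k) j
  -- Both numbers lie in `Ω'` and agree modulo `M`, and `Ω'` spans less than `M`. This makes the
  -- choice of `t` harmless.
  have hcr : c = clusterRep M x k₀ (t l k) j := by
    have hmem : clusterRep M x k₀ (t l k) j ∈ omegaSet M x k₀ :=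
      mem_omegaSet_iff.2 ⟨_, j, hj, rfl⟩
    have e1 := hrange _ hc _ hmem
    have e2 := hrange _ hmem _ hc
    have e3 : c - clusterRep M x k₀ (t l k) j =
        M * ((z + z' + ⌊x l k / M⌋ + μ * v - s : ℤ) : ℝ) := by
      unfold rem at hz
      push_cast at hx ⊢
      linarith
    set y : ℤ := z + z' + ⌊x l k / M⌋ + μ * v - s
    rcases lt_trichotomy y 0 with hy | hy | hy
    · have : (y : ℝ) ≤ -1 := by exact_mod_cast Int.le_sub_one_of_lt hy
      nlinarith
    · rw [hy] at e3
      simp only [Int.cast_zero, mul_zero] at e3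
      linarith
    · have : (1 : ℝ) ≤ y := by exact_mod_cast hy
      nlinarith
  have hlt := abs_lt.1 (hmean (t l k) j hj)
  rw [← hcr] at hlt
  have hq : qhat M x k₀ t l k = s - μ * v := by
    have e : (x l k - clusterMean M x k₀ (t l k)) / M =
        (c - clusterMean M x k₀ (t l k)) / M + ((s - μ * v : ℤ) : ℝ) := by
      field_simp
      push_cast at hx ⊢
      linarith
    have h0 : round ((c - clusterMean M x k₀ (t l k)) / M) = 0 := by
      rw [round_eq_zero_iff, Set.mem_Ico, le_div_iff₀ hM, div_lt_iff₀ hM]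
      constructor <;> linarith
    rw [qhat, e, round_add_intCast, h0, zero_add]
  rw [hq]
  exact (Int.modEq_iff_dvd.2 ⟨v, by ring⟩)

end

/-- Uniqueness applied to the pairs `(Q 0, Q 0)` and `(Q 1, Q 1)`. -/
lemma diffIdx_nonempty {K : ℕ} (hK : 2 ≤ K) (m : Fin K → ℕ) (hpos : ∀ k, 0 < m k)
    (hmono : StrictMono m) (hcop : ∀ i j, i ≠ j → Nat.Coprime (m i) (m j))
    (hthree : 3 ≤ m ⟨K - 2, by omega⟩) {Q : Fin 2 → ℤ} (hQ : ∀ l, 0 ≤ Q l ∧ Q l < dynRange m)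
    (hne : Q 0 ≠ Q 1) : (diffIdx m Q).Nonempty := by
  by_contra h
  rw [Finset.not_nonempty_iff_eq_empty, diffIdx, Finset.filter_eq_empty_iff] at h
  simp only [Finset.mem_univ, not_not, true_imp_iff] at h
  have := eq_or_eq_swap_of_residues hK m hpos hmono hcop hthree (hQ 0) (hQ 0) (hQ 1) (hQ 1)
    fun k => by rw [(ZMod.intCast_eq_intCast_iff _ _ _).2 (h (x := k))]
  rcases this with h | h <;> exact hne h.1

end RobustCRT

/-! ### The error bound for every run -/

open RobustCRT in
theorem theorem2 (K : ℕ) (hK : 2 ≤ K) (M : ℕ) (hM : 0 < M)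
    (m : Fin K → ℕ) (hpos : ∀ k, 0 < m k) (hmono : StrictMono m)
    (hcop : ∀ i j, i ≠ j → Nat.Coprime (m i) (m j))
    (hthree : 3 ≤ m ⟨K - 2, by omega⟩)
    (N : Fin 2 → ℕ) (Δr : Fin 2 → Fin K → ℝ) (τ : ℝ)
    (hτ : IsGreatest (Set.range fun p : Fin 2 × Fin K => |Δr p.1 p.2|) τ)
    (hτM : τ < (M : ℝ) / 8)
    (hlow : ∀ l k, 0 ≤ (N l : ℝ) + Δr l k)
    (hup : ∀ l, (N l : ℝ) + 3 * τ ≤ (M : ℝ) * ((RobustCRT.dynRange m : ℝ) - 1 / 2)) :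
    (∃ Nh : Fin 2 → ℝ, RobustCRT.IsEstimate (M : ℝ) m
      (fun k => s(RobustCRT.erroneousRem M m N Δr 0 k, RobustCRT.erroneousRem M m N Δr 1 k)) Nh) ∧
    ∀ Nh : Fin 2 → ℝ, RobustCRT.IsEstimate (M : ℝ) m
      (fun k => s(RobustCRT.erroneousRem M m N Δr 0 k, RobustCRT.erroneousRem M m N Δr 1 k)) Nh →
      ∃ σ : Equiv.Perm (Fin 2), ∀ l, |Nh (σ l) - (N l : ℝ)| ≤ τ := by
  have hK0 : 0 < K := by omega
  have hMR : (0 : ℝ) < M := by exact_mod_cast hM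
  have hδ : ∀ l k, |Δr l k| ≤ τ := fun l k => hτ.2 ⟨(l, k), rfl⟩
  have bounds : ∀ {s : Fin 2 → ℤ} {c : Fin 2 → Fin K → ℝ},
      (∀ l k, (N l : ℝ) + Δr l k = M * s l + c l k) → (∀ l k, c l k < M) →
      (∀ l, ∃ k, -((M : ℝ) / 2) - 2 * τ < c l k) → ∀ l, 0 ≤ s l ∧ s l < dynRange m := by
    intro s c hsc hlt hgt l
    constructor
    · have h1 := hsc l ⟨0, hK0⟩
      have h2 := hlt l ⟨0, hK0⟩
      have h3 := hlow l ⟨0, hK0⟩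
      by_contra! h
      have : (s l : ℝ) ≤ -1 := by exact_mod_cast Int.le_sub_one_of_lt h
      nlinarith
    · obtain ⟨k, hk⟩ := hgt l
      have h1 := hsc l k
      have h2 := hup l
      have h3 := (abs_le.1 (hδ l k)).2
      -- The margin `M/2 + 3τ` in `hup` is used up here: `M/2 + 2τ` by the representative and `τ` by
      -- the error.
      have h4 : (M : ℝ) * s l < M * (dynRange m : ℝ) := by linarith
      exact_mod_cast lt_of_mul_lt_mul_left h4 hMR.le
  constructor
  · set x := erroneousRem M m N Δr with hxdef
    have hx : ∀ l k, ∃ z : ℤ, (N l : ℝ) + Δr l k = x l k + M * z :=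
      fun l k => ⟨_, erroneousRem_eq M m N Δr l k⟩
    obtain ⟨k₀, hk1, hk2, hgap⟩ := exists_gap_index hK0 hMR hδ hτM hx
    obtain ⟨s, c, hsc, hc, hrange, hlt, hgt, hmean, -⟩ :=
      exists_quotient_representative hMR hk1 hk2 hgap hδ hτM (fun _ => 1) hx
    have hxc : ∀ l k, ∃ z : ℤ, x l k = c l k + M * z := fun l k => by
      obtain ⟨z, hz⟩ := hx l k
      refine ⟨s l - z, ?_⟩
      push_cast
      linarith [hsc l k]
    have ht : ∀ l k, ∃ t, ∃ j ∈ Finset.Icc 1 K,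
        circDist M (rem M (x l k)) (cluster M x k₀ t j) = 0 := by
      intro l k
      obtain ⟨t, j, hj, h⟩ := mem_omegaSet_iff.1 (hc l k)
      obtain ⟨z, hz⟩ := exists_cluster_eq (M := M) (x := x) (k₀ := k₀) t j
      obtain ⟨z', hz'⟩ := hxc l k
      refine ⟨t, j, hj, (circDist_eq_zero_iff hMR.ne').2 ⟨z' - z - ⌊x l k / M⌋, ?_⟩⟩
      unfold rem
      push_cast
      linarith
    choose t ht using ht
    have hq : ∀ l k, qhat M x k₀ t l k ≡ s l [ZMOD (m k : ℤ)] := fun l k =>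
      qhat_modEq hMR (hc l k) hrange hmean (ht l k)
        ((erroneousRem_eq M m N Δr l k).symm.trans (hsc l k))
    -- The true quotients `s` and representatives `c` themselves form a valid run.
    refine ⟨fun l => if s 0 = s 1 then M * s l + clusterMean M x k₀ l
      else M * s l + (∑ k ∈ diffIdx m s, c l k) / (diffIdx m s).card,
      x, k₀, t, s, fun _ => rfl, ⟨hk1, hk2, hgap⟩, ht, ⟨bounds hsc hlt hgt, fun k => ?_⟩,
      fun h l => if_pos h, fun h => ⟨fun _ => 1, c, fun k _ l => ⟨hq l k, hc l k, ?_⟩,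
        fun l => if_neg h⟩⟩
    · rw [Sym2.map_mk, (ZMod.intCast_eq_intCast_iff _ _ _).2 (hq 0 k),
        (ZMod.intCast_eq_intCast_iff _ _ _).2 (hq 1 k)]
    · exact (circDist_eq_zero_iff hMR.ne').2 (hxc l k)
  · rintro Nh ⟨x, k₀, t, Q, hR, ⟨hk1, hk2, hgap⟩, ht, ⟨hQ, hQS⟩, hEq, hNe⟩
    have hπ : ∀ k, ∃ π : Equiv.Perm (Fin 2), ∀ l, erroneousRem M m N Δr l k = x (π l) k :=
      fun k => exists_perm_of_sym2_eq (g := fun l => erroneousRem M m N Δr l k)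
        (h := fun l => x l k) (hR k)
    choose π hπ using hπ
    have hxe : ∀ l k, (N l : ℝ) + Δr l k =
        x (π k l) k + M * ((m k * (N l / (M * m k) : ℕ) : ℤ) : ℝ) := fun l k => by
      rw [← hπ, ← erroneousRem_eq]
    obtain ⟨s, c, hsc, hc, hrange, hlt, hgt, hmean, hsame⟩ :=
      exists_quotient_representative hMR hk1 hk2 hgap hδ hτM π fun l k => ⟨_, hxe l k⟩
    have hs := bounds hsc hlt hgt
    have hq : ∀ l k, qhat M x k₀ t (π k l) k ≡ s l [ZMOD (m k : ℤ)] := fun l k =>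
      qhat_modEq hMR (hc l k) hrange hmean (ht _ k) ((hxe l k).symm.trans (hsc l k))
    have hset : ∀ k, s((Q 0 : ZMod (m k)), (Q 1 : ZMod (m k))) =
        s((s 0 : ZMod (m k)), (s 1 : ZMod (m k))) := by
      intro k
      have hk := hQS k
      beta_reduce at hk
      rw [← hk, ← sym2_mk_perm (fun l => qhat M x k₀ t l k) (π k), Sym2.map_mk,
        (ZMod.intCast_eq_intCast_iff _ _ _).2 (hq 0 k),
        (ZMod.intCast_eq_intCast_iff _ _ _).2 (hq 1 k)]
    obtain ⟨ρ, hρ⟩ : ∃ ρ : Equiv.Perm (Fin 2), ∀ l, Q l = s (ρ l) :=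
      exists_perm_of_sym2_eq (Sym2.eq_iff.2 (eq_or_eq_swap_of_residues hK m hpos hmono hcop hthree
        (hQ 0) (hQ 1) (hs 0) (hs 1) hset))
    by_cases hQQ : Q 0 = Q 1
    · have hQc : ∀ l l', Q l = Q l' := by
        simp [Fin.forall_fin_two, hQQ]
      have hss : ∀ l l', s l = s l' := fun l l' => by
        have := hQc (ρ.symm l) (ρ.symm l')
        rwa [hρ, hρ, Equiv.apply_symm_apply, Equiv.apply_symm_apply] at this
      obtain ⟨σ, hσ⟩ := hsame (hss 0 1)
      refine ⟨σ.symm, fun l => ?_⟩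
      have := hσ (σ.symm l)
      rwa [Equiv.apply_symm_apply, hss l (ρ (σ.symm l)), ← hρ, ← hEq hQQ] at this
    · obtain ⟨p, c', hp, hNh⟩ := hNe hQQ
      have hne := diffIdx_nonempty hK m hpos hmono hcop hthree hQ hQQ
      refine ⟨ρ.symm, fun l => ?_⟩
      rw [hNh]
      refine abs_add_average_sub_le hne _ fun k hk => ?_
      obtain ⟨hp1, hp2, hp3⟩ := hp k hk (ρ.symm l)
      have hdiff : ¬ (Q 0 ≡ Q 1 [ZMOD (m k : ℤ)]) := by
        simpa [diffIdx] using hk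
      rw [hρ, Equiv.apply_symm_apply] at hp1 ⊢
      -- At an index in `diffIdx` the other member has the other residue, so the assignment `p` is
      -- forced.
      have hpl : p k (ρ.symm l) = π k l := by
        by_contra hcon
        have h1 := hq ((π k).symm (p k (ρ.symm l))) k
        rw [Equiv.apply_symm_apply] at h1
        have h2 := h1.symm.trans hp1
        have hl : (π k).symm (p k (ρ.symm l)) ≠ l := fun h =>
          hcon ((Equiv.symm_apply_eq _).1 h)
        have hQl : ∀ a b, a ≠ b → s a ≡ s b [ZMOD (m k : ℤ)] → Q 0 ≡ Q 1 [ZMOD (m k : ℤ)] := by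
          intro a b hab h
          have : ρ 0 = a ∧ ρ 1 = b ∨ ρ 0 = b ∧ ρ 1 = a := by
            have : ρ 0 ≠ ρ 1 := fun h => zero_ne_one (ρ.injective h)
            omega
          rw [hρ 0, hρ 1]
          rcases this with ⟨e1, e2⟩ | ⟨e1, e2⟩ <;> rw [e1, e2]
          exacts [h, h.symm]
        exact hdiff (hQl _ _ hl h2)
      rw [hpl] at hp3
      obtain ⟨z, hz⟩ := (circDist_eq_zero_iff hMR.ne').1 hp3
      have e1 := hrange _ hp2 _ (hc l k)
      have e2 := hrange _ (hc l k) _ hp2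
      have hcc : c' (ρ.symm l) k = c l k := by
        have e3 := hsc l k
        rw [hxe l k, hz] at e3
        have e4 : c l k - c' (ρ.symm l) k =
            M * ((z + m k * (N l / (M * m k) : ℕ) - s l : ℤ) : ℝ) := by
          push_cast at e3 ⊢
          linarith
        set y : ℤ := z + m k * (N l / (M * m k) : ℕ) - s l
        rcases lt_trichotomy y 0 with hy | hy | hy
        · have : (y : ℝ) ≤ -1 := by exact_mod_cast Int.le_sub_one_of_lt hy
          nlinarith
        · rw [hy] at e4
          simp only [Int.cast_zero, mul_zero] at e4
          linarith
        · have : (1 : ℝ) ≤ y := by exact_mod_cast hy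
          nlinarith
      rw [hcc, ← hsc, add_sub_cancel_left]
      exact hδ l k
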